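/- **Theorem ($C^1$-interpolation theorem; Agronsky, Bruckner, Laczkovich, Preiss).** For every continuous function $f\colon\mathbb R\to\mathbb R$ there exists a continuously differentiable function $g\colon\mathbb R\to\mathbb R$ such that the set $[f=g]:=\{x\in\mathbb R\colon f(x)=g(x)\}$ is uncountable. In particular, $[f=g]$ contains a nonempty perfect set $P$ (that is, a nonempty closed set $P\subset\mathbb R$ without isolated points) such that the restriction $f\restriction P$ is continuously differentiable, i.e., for every $p\in P$ the limit $$(f\restriction P)'(p):=\lim_{x\to p,\ x\in P\setminus\{p\}}\frac{f(x)-f(p)}{x-p}$$ exists and is finite, and $(f\restriction P)'\colon P\to\mathbb R$ is continuous. -/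

import Mathlib

open Set Filter Topology

/-! It suffices to find a nonempty `T` and slopes `c` with `HasSlopesAlong f c T`. Given these,
start from a line through one point of `T` and repeatedly add, near every node, a new node in `T`.
Being to first order on the current curve, it costs a correction small in C¹ norm. The corrections
sum to a C¹ function `g` equal to `f` at all nodes; these have no isolated point, so their closure
is perfect. To find the slopes: if `f` is differentiable at uncountably many points, use the
derivative at the condensation points of its graph. Otherwise Lebesgue's theorem forbids injectivity
on any interval, Baire category makes the points with derived number `0` dense, and `c = 0` works.
-/

/-- Every point `x` of `T` is approached by points of `T` along which the difference quotients of
`f` at `x` come close to `c x`, and at which `c` comes close to `c x`. -/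
def HasSlopesAlong (f c : ℝ → ℝ) (T : Set ℝ) : Prop :=
  ∀ x ∈ T, ∀ ε > 0, ∃ y ∈ T, y ≠ x ∧ |y - x| < ε ∧ |c y - c x| < ε ∧
    |f y - f x - c x * (y - x)| ≤ ε * |y - x|

/-- `g` is a `C¹` function with derivative `g'`, and it agrees to first order with the pair `f`, `c`
on the finite subset `F` of `T`. -/
structure HermiteInterpolant (f c : ℝ → ℝ) (T : Set ℝ) (g g' : ℝ → ℝ) (F : Finset ℝ) : Prop where
  hasDerivAt : ∀ t, HasDerivAt g (g' t) t
  continuous : Continuous g'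
  subset : ∀ x ∈ F, x ∈ T
  value : ∀ x ∈ F, g x = f x
  slope : ∀ x ∈ F, g' x = c x

/-! ### From slopes to a C¹ interpolant -/

theorem exists_bound_hermite_bump :
    ∃ M > 0, ∀ p r a b : ℝ, 0 < r → ∃ e e' : ℝ → ℝ, (∀ t, HasDerivAt e (e' t) t) ∧
      Continuous e' ∧ (∀ t, |e t| ≤ M * (|a| + |b| * r)) ∧ (∀ t, |e' t| ≤ M * (|a| / r + |b|)) ∧
      (∀ t, r ≤ |t - p| → e t = 0 ∧ e' t = 0) ∧ e p = a ∧ e' p = b := by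
  let φ : ContDiffBump (0 : ℝ) := ⟨1 / 2, 1, by norm_num, by norm_num⟩
  have hφ : ContDiff ℝ 1 φ := φ.contDiff
  have hd : Continuous (deriv φ) := hφ.continuous_deriv le_rfl
  obtain ⟨C, hC⟩ := φ.hasCompactSupport.deriv.exists_bound_of_continuous hd
  have hC0 : 0 ≤ C := (norm_nonneg _).trans (hC 0)
  have hout : ∀ u : ℝ, 1 ≤ |u| → φ u = 0 := fun u hu =>
    φ.zero_of_le_dist (by simpa [Real.dist_eq] using hu)
  -- Such `u` minimize `φ`; this covers the boundary `|u| = 1` too.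
  have hout' : ∀ u : ℝ, 1 ≤ |u| → deriv φ u = 0 := fun u hu =>
    IsLocalMin.deriv_eq_zero (Eventually.of_forall fun v => by
      rw [hout u hu]; exact φ.nonneg)
  have h0 : φ 0 = 1 := φ.one_of_mem_closedBall (by simp [φ])
  have h0' : deriv φ 0 = 0 :=
    IsLocalMax.deriv_eq_zero (Eventually.of_forall fun v => by
      rw [h0]; exact φ.le_one)
  have hφ1 : ∀ u, |φ u| ≤ 1 := fun u => by
    rw [abs_of_nonneg φ.nonneg]; exact φ.le_one
  refine ⟨C + 1, by positivity, fun p r a b hr => ?_⟩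
  have hs : ∀ t, HasDerivAt (fun t => (t - p) / r) (1 / r) t := fun t =>
    ((hasDerivAt_id t).sub_const p).div_const r
  refine ⟨fun t => φ ((t - p) / r) * (a + b * (t - p)),
    fun t => deriv φ ((t - p) / r) * (1 / r) * (a + b * (t - p)) + φ ((t - p) / r) * b,
    fun t => ?_, ?_, fun t => ?_, fun t => ?_, fun t ht => ?_, ?_, ?_⟩
  · have h1 := ((hφ.differentiable one_ne_zero).differentiableAt.hasDerivAt
      (x := (t - p) / r)).comp t (hs t)
    have h2 : HasDerivAt (fun t => a + b * (t - p)) b t := by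
      simpa using (((hasDerivAt_id t).sub_const p).const_mul b).const_add a
    exact h1.mul h2
  · have := φ.continuous
    fun_prop
  · have hlin : ∀ t, |t - p| < r → |a + b * (t - p)| ≤ |a| + |b| * r := fun t ht => by
      refine (abs_add_le _ _).trans ?_
      rw [abs_mul]; gcongr
    rcases lt_or_ge |t - p| r with ht | ht
    · rw [abs_mul]
      calc |φ ((t - p) / r)| * |a + b * (t - p)| ≤ 1 * (|a| + |b| * r) := by
            gcongr
            exacts [hφ1 _, hlin t ht]
        _ ≤ _ := by gcongr; linarith
    · have : 1 ≤ |(t - p) / r| := by rwa [abs_div, abs_of_pos hr, one_le_div hr]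
      simp only [hout _ this, zero_mul, abs_zero]; positivity
  · rcases lt_or_ge |t - p| r with ht | ht
    · have hlin : |a + b * (t - p)| ≤ |a| + |b| * r := by
        refine (abs_add_le _ _).trans ?_
        rw [abs_mul]; gcongr
      refine (abs_add_le _ _).trans ?_
      rw [abs_mul, abs_mul, abs_mul, abs_of_pos (show 0 < 1 / r by positivity)]
      calc _ ≤ C * (1 / r) * (|a| + |b| * r) + 1 * |b| := by
            gcongr
            exacts [hC _, hφ1 _]
        _ = C * (|a| / r + |b|) + |b| := by field_simp
        _ ≤ _ := by
            have : 0 ≤ |a| / r := by positivity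
            linarith
    · have : 1 ≤ |(t - p) / r| := by rwa [abs_div, abs_of_pos hr, one_le_div hr]
      simp only [hout _ this, hout' _ this, zero_mul, add_zero, abs_zero]; positivity
  · have : 1 ≤ |(t - p) / r| := by rwa [abs_div, abs_of_pos hr, one_le_div hr]
    simp [hout _ this, hout' _ this]
  · simp [h0]
  · simp [h0, h0']

namespace HermiteInterpolant

variable {f c g g' : ℝ → ℝ} {T : Set ℝ} {F : Finset ℝ}

/-- The bump at `y` has radius `|y - x|`, so it leaves `x` untouched, and the other nodes too once
`y` is close to `x`. The value error is `O(η |y - x|)`, hence still `O(η)` after division by the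
radius. -/
theorem exists_insert (hT : HasSlopesAlong f c T) (h : HermiteInterpolant f c T g g' F)
    {x : ℝ} (hx : x ∈ F) {ε : ℝ} (hε : 0 < ε) :
    ∃ (k k' : ℝ → ℝ) (y : ℝ), HermiteInterpolant f c T k k' (insert y F) ∧
      (∀ t, |k t - g t| ≤ ε) ∧ (∀ t, |k' t - g' t| ≤ ε) ∧ y ≠ x ∧ |y - x| < ε := by
  obtain ⟨M, hM, bump⟩ := exists_bound_hermite_bump
  obtain ⟨η, hη, hη1, hηε, hηM⟩ : ∃ η > 0, η ≤ 1 ∧ η ≤ ε ∧ M * (4 * η) ≤ ε := by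
    refine ⟨min 1 (min ε (ε / (4 * M))), by positivity, min_le_left _ _,
      (min_le_right _ _).trans (min_le_left _ _), ?_⟩
    have : min 1 (min ε (ε / (4 * M))) ≤ ε / (4 * M) :=
      (min_le_right _ _).trans (min_le_right _ _)
    rw [le_div_iff₀ (by positivity)] at this
    linarith
  have h1 : ∀ᶠ y in 𝓝 x, |g y - g x - g' x * (y - x)| ≤ η * |y - x| := by
    have := (hasDerivAt_iff_isLittleO.1 (h.hasDerivAt x)).bound hη
    simpa [Real.norm_eq_abs, mul_comm] using this
  have h2 : ∀ᶠ y in 𝓝 x, |g' y - g' x| < η := by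
    simpa [Real.dist_eq] using Metric.tendsto_nhds.1 h.continuous.continuousAt η hη
  have h3 : ∀ᶠ y in 𝓝 x, ∀ z ∈ F, z ≠ x → |y - x| < |z - y| := by
    rw [eventually_all_finset]
    intro z _
    by_cases hz : z = x
    · simp [hz]
    have : ∀ᶠ y in 𝓝 x, |y - x| < |z - y| := by
      refine ContinuousAt.eventually_lt (by fun_prop) (by fun_prop) ?_
      simpa [sub_eq_zero] using hz
    exact this.mono fun y hy _ => hy
  obtain ⟨δ, hδ, hball⟩ := Metric.eventually_nhds_iff.1 (h1.and (h2.and h3))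
  obtain ⟨y, hyT, hyx, hyδ, hc, hf⟩ := hT x (h.subset x hx) (min η δ) (lt_min hη hδ)
  obtain ⟨g1, g2, g3⟩ := hball (y := y)
    (by rw [Real.dist_eq]; exact hyδ.trans_le (min_le_right _ _))
  have hr : 0 < |y - x| := abs_pos.2 (sub_ne_zero.2 hyx)
  have hrη : |y - x| < η := hyδ.trans_le (min_le_left _ _)
  have ha : |f y - g y| ≤ 2 * η * |y - x| := by
    have hf' : |f y - f x - c x * (y - x)| ≤ η * |y - x| :=
      hf.trans (by gcongr; exact min_le_left _ _)
    have : f y - g y = (f y - f x - c x * (y - x)) - (g y - g x - g' x * (y - x)) := by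
      rw [h.value x hx, h.slope x hx]; ring
    rw [this]
    refine (abs_sub _ _).trans ?_
    linarith
  have hb : |c y - g' y| ≤ 2 * η := by
    have : c y - g' y = (c y - c x) - (g' y - g' x) := by rw [h.slope x hx]; ring
    rw [this]
    refine (abs_sub _ _).trans ?_
    linarith [hc.le.trans (min_le_left η δ)]
  obtain ⟨e, e', he, he', hbd, hbd', hvan, hey, hey'⟩ :=
    bump y |y - x| (f y - g y) (c y - g' y) hr
  have hF : ∀ z ∈ F, e z = 0 ∧ e' z = 0 := fun z hz => by
    refine hvan z ?_
    by_cases hzx : z = x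
    · rw [hzx, abs_sub_comm]
    · exact (g3 z hz hzx).le
  refine ⟨fun t => g t + e t, fun t => g' t + e' t, y,
    ⟨fun t => (h.hasDerivAt t).add (he t), h.continuous.add he', ?_, ?_, ?_⟩, ?_, ?_, hyx,
    hrη.trans_le hηε⟩
  · simpa [hyT] using h.subset
  · intro z hz
    rcases Finset.mem_insert.1 hz with rfl | hz
    · simp [hey]
    · simp [hF z hz, h.value z hz]
  · intro z hz
    rcases Finset.mem_insert.1 hz with rfl | hz
    · simp [hey']
    · simp [hF z hz, h.slope z hz]
  · intro t
    rw [add_sub_cancel_left]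
    refine (hbd t).trans (le_trans ?_ hηM)
    gcongr
    have : η * |y - x| ≤ η * 1 := by gcongr; linarith
    have : |c y - g' y| * |y - x| ≤ 2 * η * |y - x| := by gcongr
    linarith
  · intro t
    rw [add_sub_cancel_left]
    refine (hbd' t).trans (le_trans ?_ hηM)
    gcongr
    have := (div_le_iff₀ hr).2 ha
    linarith

theorem exists_refinement (hT : HasSlopesAlong f c T) (h : HermiteInterpolant f c T g g' F)
    {ε : ℝ} (hε : 0 < ε) :
    ∃ (k k' : ℝ → ℝ) (G : Finset ℝ), HermiteInterpolant f c T k k' G ∧ F ⊆ G ∧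
      (∀ t, |k t - g t| ≤ ε) ∧ (∀ t, |k' t - g' t| ≤ ε) ∧
      ∀ x ∈ F, ∃ y ∈ G, y ≠ x ∧ |y - x| < ε := by
  -- The C¹ budget `δ` is split off from `ε` so that it can be halved at each node.
  suffices H : ∀ A ⊆ F, ∀ δ > 0, δ ≤ ε →
      ∃ (k k' : ℝ → ℝ) (G : Finset ℝ), HermiteInterpolant f c T k k' G ∧ F ⊆ G ∧
      (∀ t, |k t - g t| ≤ δ) ∧ (∀ t, |k' t - g' t| ≤ δ) ∧
      ∀ x ∈ A, ∃ y ∈ G, y ≠ x ∧ |y - x| < ε from H F subset_rfl ε hε le_rfl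
  intro A
  induction A using Finset.induction_on with
  | empty =>
    intro _ δ hδ _
    exact ⟨g, g', F, h, subset_rfl, by simp [hδ.le], by simp [hδ.le], by simp⟩
  | insert a A _ ih =>
    intro hA δ hδ hδε
    obtain ⟨k, k', G, hk, hFG, hd, hd', hnear⟩ :=
      ih ((Finset.subset_insert _ _).trans hA) (δ / 2) (by positivity) (by linarith)
    obtain ⟨l, l', y, hl, hld, hld', hya, hy⟩ :=
      hk.exists_insert hT (hFG (hA (Finset.mem_insert_self a A))) (half_pos hδ)
    refine ⟨l, l', insert y G, hl, hFG.trans (Finset.subset_insert _ _), fun t => ?_,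
      fun t => ?_, fun x hx => ?_⟩
    · linarith [abs_sub_le (l t) (k t) (g t), hld t, hd t]
    · linarith [abs_sub_le (l' t) (k' t) (g' t), hld' t, hd' t]
    · rcases Finset.mem_insert.1 hx with rfl | hx
      · exact ⟨y, Finset.mem_insert_self _ _, hya, by linarith⟩
      · obtain ⟨z, hz, hzx⟩ := hnear x hx
        exact ⟨z, Finset.mem_insert_of_mem hz, hzx⟩

end HermiteInterpolant

theorem exists_contDiff_of_geometric_approx {g g' : ℕ → ℝ → ℝ}
    (hg : ∀ n t, HasDerivAt (g n) (g' n t) t) (hg' : ∀ n, Continuous (g' n))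
    (hd : ∀ n t, |g (n + 1) t - g n t| ≤ 1 / 2 / 2 ^ n)
    (hd' : ∀ n t, |g' (n + 1) t - g' n t| ≤ 1 / 2 / 2 ^ n) :
    ∃ k : ℝ → ℝ, ContDiff ℝ 1 k ∧ ∀ t, Tendsto (fun n => g n t) atTop (𝓝 (k t)) := by
  have lim : ∀ u : ℕ → ℝ → ℝ, (∀ n t, |u (n + 1) t - u n t| ≤ 1 / 2 / 2 ^ n) →
      ∃ k : ℝ → ℝ, ∀ t, Tendsto (fun n => u n t) atTop (𝓝 (k t)) := fun u hu => by
    have : ∀ t, ∃ l, Tendsto (fun n => u n t) atTop (𝓝 l) := fun t =>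
      cauchySeq_tendsto_of_complete (cauchySeq_of_le_geometric_two (C := 1) fun n => by
        rw [dist_comm, Real.dist_eq]; exact hu n t)
    choose k hk using this
    exact ⟨k, hk⟩
  obtain ⟨k, hk⟩ := lim g hd
  obtain ⟨k', hk'⟩ := lim g' hd'
  have hunif : TendstoUniformly g' k' atTop := by
    rw [Metric.tendstoUniformly_iff]
    intro ε hε
    have : Tendsto (fun n : ℕ => (1 : ℝ) / 2 ^ n) atTop (𝓝 0) := by
      simpa using tendsto_pow_atTop_nhds_zero_of_lt_one (r := (1 / 2 : ℝ)) (by norm_num)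
        (by norm_num)
    filter_upwards [this.eventually_lt_const hε] with n hn t
    rw [dist_comm]
    refine lt_of_le_of_lt (dist_le_of_le_geometric_two_of_tendsto (C := 1) (fun n => ?_)
      (hk' t) n) hn
    rw [dist_comm, Real.dist_eq]; exact hd' n t
  have hderiv : ∀ t, HasDerivAt k (k' t) t :=
    hasDerivAt_of_tendstoUniformly hunif (Eventually.of_forall hg) hk
  refine ⟨k, contDiff_one_iff_deriv.2 ⟨fun t => (hderiv t).differentiableAt, ?_⟩, hk⟩
  rw [funext fun t => (hderiv t).deriv]
  exact hunif.continuous (Frequently.of_forall hg')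

theorem HasSlopesAlong.exists_contDiff_perfect {f c : ℝ → ℝ} {T : Set ℝ} (hf : Continuous f)
    (hT : HasSlopesAlong f c T) (hne : T.Nonempty) :
    ∃ g : ℝ → ℝ, ContDiff ℝ 1 g ∧ ∃ P : Set ℝ, Perfect P ∧ P.Nonempty ∧ P ⊆ {x | f x = g x} := by
  obtain ⟨x₀, hx₀⟩ := hne
  let S := {p : (ℝ → ℝ) × (ℝ → ℝ) × Finset ℝ // HermiteInterpolant f c T p.1 p.2.1 p.2.2}
  let s₀ : S := ⟨(fun t => f x₀ + c x₀ * (t - x₀), fun _ => c x₀, {x₀}),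
    { hasDerivAt := fun t => by
        simpa using (((hasDerivAt_id t).sub_const x₀).const_mul (c x₀)).const_add (f x₀)
      continuous := continuous_const
      subset := by simpa using hx₀
      value := by simp
      slope := by simp }⟩
  have step : ∀ (n : ℕ) (s : S), ∃ s' : S, s.1.2.2 ⊆ s'.1.2.2 ∧
      (∀ t, |s'.1.1 t - s.1.1 t| ≤ 1 / 2 / 2 ^ n) ∧
      (∀ t, |s'.1.2.1 t - s.1.2.1 t| ≤ 1 / 2 / 2 ^ n) ∧
      ∀ x ∈ s.1.2.2, ∃ y ∈ s'.1.2.2, y ≠ x ∧ |y - x| < 1 / 2 / 2 ^ n := fun n s => by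
    obtain ⟨k, k', G, hk, h⟩ :=
      s.2.exists_refinement hT (show (0 : ℝ) < 1 / 2 / 2 ^ n by positivity)
    exact ⟨⟨(k, k', G), hk⟩, h⟩
  choose next hsub hd hd' hnear using step
  let s : ℕ → S := fun n => Nat.rec s₀ next n
  obtain ⟨g, hg, hlim⟩ := exists_contDiff_of_geometric_approx (g := fun n => (s n).1.1)
    (g' := fun n => (s n).1.2.1) (fun n => (s n).2.hasDerivAt) (fun n => (s n).2.continuous)
    (fun n => hd n (s n)) (fun n => hd' n (s n))
  have hmono : Monotone fun n => (s n).1.2.2 := monotone_nat_of_le_succ fun n => hsub n (s n)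
  let E : Set ℝ := {x | ∃ n, x ∈ (s n).1.2.2}
  have hE : Preperfect E := by
    rw [preperfect_iff_nhds]
    rintro x ⟨n, hn⟩ U hU
    obtain ⟨ε, hε, hball⟩ := Metric.mem_nhds_iff.1 hU
    have : Tendsto (fun n : ℕ => (1 : ℝ) / 2 / 2 ^ n) atTop (𝓝 0) := by
      simpa [div_eq_mul_inv] using (tendsto_pow_atTop_nhds_zero_of_lt_one (r := (2⁻¹ : ℝ))
        (by norm_num) (by norm_num)).const_mul (2⁻¹ : ℝ)
    obtain ⟨m, hm, hnm⟩ := ((this.eventually_lt_const hε).and (eventually_ge_atTop n)).exists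
    obtain ⟨y, hy, hyx, hlt⟩ := hnear m (s m) x (hmono hnm hn)
    exact ⟨y, ⟨hball (by rw [Metric.mem_ball, Real.dist_eq]; exact hlt.trans hm), m + 1, hy⟩, hyx⟩
  refine ⟨g, hg, closure E, hE.perfect_closure, ⟨x₀, subset_closure ⟨0, ?_⟩⟩,
    closure_minimal ?_ (isClosed_eq hf hg.continuous)⟩
  · simp [s, s₀]
  · rintro x ⟨n, hn⟩
    refine tendsto_nhds_unique (tendsto_const_nhds.congr' ?_) (hlim x)
    filter_upwards [eventually_ge_atTop n] with m hm
    exact ((s m).2.value x (hmono hm hn)).symm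

/-! ### Existence of slopes -/

theorem exists_hasSlopesAlong_of_not_countable {f : ℝ → ℝ}
    (hD : ¬ {x | DifferentiableAt ℝ f x}.Countable) :
    ∃ (c : ℝ → ℝ) (T : Set ℝ), HasSlopesAlong f c T ∧ T.Nonempty := by
  set D := {x | DifferentiableAt ℝ f x}
  let γ : ℝ → ℝ × ℝ := fun x => (x, deriv f x)
  -- The points that are not condensation points of the graph of the derivative; a countable basis
  -- shows that they are countably many.
  let N : Set ℝ := {x ∈ D | ∃ U ∈ 𝓝 (γ x), (D ∩ γ ⁻¹' U).Countable}
  have hN : N.Countable := by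
    obtain ⟨B, hBc, -, hB⟩ := TopologicalSpace.exists_countable_basis (ℝ × ℝ)
    refine ((hBc.mono (sep_subset B fun V => (D ∩ γ ⁻¹' V).Countable)).biUnion
      (t := fun V _ => D ∩ γ ⁻¹' V) fun V hV => hV.2).mono ?_
    rintro x ⟨hxD, U, hU, hc⟩
    obtain ⟨V, hV, hxV, hVU⟩ := hB.mem_nhds_iff.1 hU
    exact mem_biUnion (x := V)
      ⟨hV, hc.mono (inter_subset_inter_right _ (preimage_mono hVU))⟩ ⟨hxD, hxV⟩
  refine ⟨deriv f, D \ N, fun x hx ε hε => ?_, ?_⟩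
  · have hx' : DifferentiableAt ℝ f x := hx.1
    have hlo : ∀ᶠ y in 𝓝 x, |f y - f x - deriv f x * (y - x)| ≤ ε * |y - x| := by
      have := (hasDerivAt_iff_isLittleO.1 hx'.hasDerivAt).bound hε
      simpa [Real.norm_eq_abs, mul_comm] using this
    obtain ⟨δ, hδ, hball⟩ := Metric.eventually_nhds_iff.1 hlo
    have hunc : ¬ (D ∩ γ ⁻¹' Metric.ball (γ x) (min ε δ)).Countable := fun hc =>
      hx.2 ⟨hx.1, _, Metric.ball_mem_nhds _ (lt_min hε hδ), hc⟩
    obtain ⟨y, ⟨hyD, hyU⟩, hy⟩ : ((D ∩ γ ⁻¹' Metric.ball (γ x) (min ε δ)) \ (N ∪ {x})).Nonempty := by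
      rw [nonempty_iff_ne_empty, Ne, sdiff_eq_empty]
      exact fun h => hunc ((hN.union (countable_singleton x)).mono h)
    rw [mem_union, not_or] at hy
    have hyU' : dist y x < min ε δ ∧ dist (deriv f y) (deriv f x) < min ε δ := by
      simpa only [γ, mem_preimage, Metric.mem_ball, Prod.dist_eq, max_lt_iff] using hyU
    exact ⟨y, ⟨hyD, hy.1⟩, hy.2, by simpa [Real.dist_eq] using hyU'.1.trans_le (min_le_left _ _),
      by simpa [Real.dist_eq] using hyU'.2.trans_le (min_le_left _ _),
      hball (hyU'.1.trans_le (min_le_right _ _))⟩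
  · rw [nonempty_iff_ne_empty, Ne, sdiff_eq_empty]
    exact fun h => hD (hN.mono h)

/-- A continuous injection of an interval is monotone, hence differentiable almost everywhere there.
-/
theorem not_countable_differentiableAt_of_injOn {f : ℝ → ℝ} (hf : Continuous f) {a b : ℝ}
    (hab : a < b) (hinj : InjOn f (Ioo a b)) : ¬ {x | DifferentiableAt ℝ f x}.Countable := by
  intro hc
  have hae : ∀ᵐ x, x ∈ Ioo a b → DifferentiableWithinAt ℝ f (Ioo a b) x := by
    rcases hf.continuousOn.strictMonoOn_of_injOn_Ioo hab hinj with h | h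
    · exact h.monotoneOn.ae_differentiableWithinAt_of_mem
    · have := (h.antitoneOn.neg).ae_differentiableWithinAt_of_mem
      filter_upwards [this] with x hx hxI
      simpa using (hx hxI).neg
  have hnull := hc.ae_notMem MeasureTheory.volume
  have : ∀ᵐ x, x ∉ Ioo a b := by
    filter_upwards [hae, hnull] with x h1 h2 hx
    exact h2 ((h1 hx).differentiableAt (isOpen_Ioo.mem_nhds hx))
  have h0 : MeasureTheory.volume (Ioo a b) = 0 := MeasureTheory.measure_eq_zero_iff_ae_notMem.2 this
  simp [Real.volume_Ioo] at h0
  linarith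

/-- If `f` is injective on no interval, then the set of points at which `0` is a derived number
of `f` is dense. -/
theorem dense_zero_derivedNumber {f : ℝ → ℝ} (hf : Continuous f)
    (hinj : ∀ a b : ℝ, a < b → ¬ InjOn f (Ioo a b)) :
    Dense {x | ∀ ε > 0, ∃ y, y ≠ x ∧ |y - x| < ε ∧ |f y - f x| ≤ ε * |y - x|} := by
  set T := {x | ∀ ε > 0, ∃ y, y ≠ x ∧ |y - x| < ε ∧ |f y - f x| ≤ ε * |y - x|}
  -- Near a point of `X n`, `f` expands distances by at least `1 / (n + 1)`; an interval of such
  -- points, if short, would make `f` injective on it.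
  let X : ℕ → Set ℝ := fun n =>
    {x | ∀ y, (1 : ℝ) / (n + 1) ≤ |y - x| ∨ 1 / (n + 1) * |y - x| ≤ |f y - f x|}
  have hX : ∀ n, IsClosed (X n) := fun n => by
    simp only [X, ofPred_forall, ofPred_or]
    exact isClosed_iInter fun y =>
      (isClosed_le continuous_const (by fun_prop)).union (isClosed_le (by fun_prop) (by fun_prop))
  have hXint : ∀ n, Dense (X n)ᶜ := fun n => by
    rw [← interior_eq_empty_iff_dense_compl, ← not_nonempty_iff_eq_empty]
    rintro ⟨x, hx⟩
    obtain ⟨ε, hε, hball⟩ := Metric.mem_nhds_iff.1 (mem_interior_iff_mem_nhds.1 hx)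
    have hn : (0 : ℝ) < 1 / (n + 1) := by positivity
    set r := min ε (1 / (n + 1) / 2)
    have hr : 0 < r := lt_min hε (half_pos hn)
    have hr1 : r ≤ ε := min_le_left _ _
    have hr2 : r ≤ 1 / (n + 1) / 2 := min_le_right _ _
    refine hinj (x - r) (x + r) (by linarith) fun u hu v hv huv => ?_
    have huX : u ∈ X n := hball (by
      rw [Metric.mem_ball, Real.dist_eq, abs_lt]; constructor <;> linarith [hu.1, hu.2])
    rcases huX v with h | h
    · have : |v - u| < 1 / (n + 1) := by
        rw [abs_lt]; constructor <;> linarith [hu.1, hu.2, hv.1, hv.2]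
      exact absurd h this.not_ge
    · rw [huv, sub_self, abs_zero] at h
      have : |v - u| ≤ 0 := nonpos_of_mul_nonpos_right h hn
      exact (sub_eq_zero.1 (abs_nonpos_iff.1 this)).symm
  refine (dense_iInter_of_isOpen (fun n => (hX n).isOpen_compl) hXint).mono fun x hx ε hε => ?_
  obtain ⟨n, hn⟩ := exists_nat_one_div_lt hε
  have hx := mem_iInter.1 hx n
  simp only [X, mem_compl_iff, mem_ofPred_eq, not_forall, not_or, not_le] at hx
  obtain ⟨y, hy1, hy2⟩ := hx
  refine ⟨y, ?_, hy1.trans hn, hy2.le.trans (by gcongr)⟩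
  rintro rfl
  simp at hy2

theorem exists_hasSlopesAlong {f : ℝ → ℝ} (hf : Continuous f) :
    ∃ (c : ℝ → ℝ) (T : Set ℝ), HasSlopesAlong f c T ∧ T.Nonempty := by
  by_cases hD : {x | DifferentiableAt ℝ f x}.Countable
  swap
  · exact exists_hasSlopesAlong_of_not_countable hD
  have hdense := dense_zero_derivedNumber hf fun a b hab hinj =>
    not_countable_differentiableAt_of_injOn hf hab hinj hD
  refine ⟨fun _ => 0, _, fun x hx ε hε => ?_, hdense.nonempty⟩
  obtain ⟨y, hyx, hy, hfy⟩ := hx (ε / 2) (half_pos hε)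
  have hpos : 0 < |y - x| := abs_pos.2 (sub_ne_zero.2 hyx)
  have h1 : ∀ᶠ z in 𝓝 y, |z - x| < ε :=
    ContinuousAt.eventually_lt (by fun_prop) (by fun_prop) (by linarith)
  have h2 : ∀ᶠ z in 𝓝 y, |f z - f x| < ε * |z - x| :=
    ContinuousAt.eventually_lt (by fun_prop) (by fun_prop)
      (hfy.trans_lt (by gcongr; linarith))
  -- `y` need not lie in the dense set, but the bounds, made strict by the slack `ε / 2`, persist at
  -- a nearby `z` that does.
  obtain ⟨z, hzT, hz1, hz2⟩ :=
    ((mem_closure_iff_frequently.1 (hdense y)).and_eventually (h1.and h2)).exists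
  refine ⟨z, hzT, ?_, hz1, by simpa using hε, by simpa using hz2.le⟩
  rintro rfl
  simp at hz2

theorem Perfect.not_countable_of_nonempty {P : Set ℝ} (hP : Perfect P) (hne : P.Nonempty) :
    ¬ P.Countable := by
  intro hc
  obtain ⟨φ, hφ, -, hinj⟩ := hP.exists_nat_bool_injection hne
  have : (univ : Set (ℕ → Bool)).Countable := by
    refine (hc.mono hφ).preimage_of_injOn hinj.injOn |>.mono fun x _ => ?_
    exact mem_range_self x
  rw [countable_univ_iff, ← Cardinal.mk_le_aleph0_iff] at this
  exact Cardinal.aleph0_lt_continuum.not_ge (by simpa using this)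

theorem mainTheorem5 (f : ℝ → ℝ) (hf : Continuous f) :
    ∃ g : ℝ → ℝ, ContDiff ℝ 1 g ∧
      ¬ {x : ℝ | f x = g x}.Countable ∧
      ∃ P : Set ℝ, Perfect P ∧ P.Nonempty ∧ P ⊆ {x : ℝ | f x = g x} ∧
        DifferentiableOn ℝ f P ∧ ContinuousOn (derivWithin f P) P := by
  obtain ⟨c, T, hT, hne⟩ := exists_hasSlopesAlong hf
  obtain ⟨g, hg, P, hP, hPne, hPg⟩ := hT.exists_contDiff_perfect hf hne
  have hderiv : ∀ x ∈ P, HasDerivWithinAt f (deriv g x) P x := fun x hx =>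
    (((hg.differentiable one_ne_zero) x).hasDerivAt.hasDerivWithinAt).congr hPg (hPg hx)
  refine ⟨g, hg, fun hc => hP.not_countable_of_nonempty hPne (hc.mono hPg), P, hP, hPne, hPg,
    fun x hx => (hderiv x hx).differentiableWithinAt, ?_⟩
  refine (hg.continuous_deriv le_rfl).continuousOn.congr fun x hx => ?_
  exact (hderiv x hx).derivWithin (uniqueDiffWithinAt_iff_accPt.2 (hP.acc x hx))
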